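/- \textbf{Setting.} For $n\ge 0$ let $\mathcal H_n$ be the antisymmetric Fock space over $\mathbb C^n$, with occupation basis $|u_1,\dots,u_n\rangle$, $u_i\in\{0,1\}$, annihilation operators $c_i|u\rangle=\delta_{u_i,1}\prod_{k<i}(-1)^{u_k}|u_1,\dots,u_i-1,\dots,u_n\rangle$ and number operator $N=\sum_i c_i^*c_i$. Let $F=(c_1,\dots,c_n,c_1^*,\dots,c_n^*)^T$ be the column of creation/annihilation operators and $(\gamma_1,\dots,\gamma_{2n})^T=B_nF$ the Majorana operators, where $B_n=\begin{pmatrix} I&I\\-iI&iI\end{pmatrix}$; that is, $\gamma_i=c_i+c_i^*$ and $\gamma_{i+n}=-i(c_i-c_i^*)$. An operator of (or between) the phase spaces $\mathbb C^{2m},\mathbb C^{2n}$ with matrix $A_c$ in the creation/annihilation basis has matrix $A=\frac12B_mA_cB_n^*$ in the Majorana basis. Below all phase space operators are identified with their Majorana matrices, while for columns $F,G$ the expression $F^*AG$ means $\sum_{k,l}(A_c)_{kl}F_k^*G_l$. Thus, in terms of Majorana operators, $F^*AG=\frac12\sum_{k,l}A_{kl}\gamma_k\gamma'_l$, where $\gamma,\gamma'$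 are the Majorana operators belonging to $F,G$. A state is a positive operator of trace $1$. The covariance matrix of a state $\rho$ is the operator whose matrix in the creation/annihilation basis is $(\mathrm{Tr}(\rho F_kF_l^*))_{k,l}$; its Majorana matrix is $\frac12(\mathrm{Tr}(\rho\gamma_k\gamma_l))_{k,l}$. A state is Gaussian if it is $e^{-\beta H}/\mathrm{Tr}(e^{-\beta H})$ with $\beta\in\mathbb R$ and $H=F^*TF$ self-adjoint; a limit of Gaussian states is called quasi-free. Let $\mathcal H_S=\mathcal H_L$ (system) and $\mathcal H_B=\mathcal H_K$ (bath), with columns $F_S,F_B$. Let the operators of $\mathcal H_S$ and $\mathcal H_B$ act on $\mathcal H_S\otimes\mathcal H_B$ by one of the two conventions $$E_{SB}:\ c_i^S\mapsto c_i^S\otimes I,\quad c_i^B\mapsto(-1)^{N_S}\otimes c_i^B;\qquad E_{BS}:\ c_i^S\mapsto c_i^S\otimes(-1)^{N_B},\quad c_i^B\mapsto I\otimes c_i^B .$$ Let $T_S=iR_S$, $T_B=iR_B$ with $R_S\in\mathbb R^{2L\times 2L}$, $R_B\in\mathbb R^{2K\times 2K}$ antisymmetric, $\Theta=iW$ with $W\in\mathbb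 R^{2L\times 2K}$, and $$H_S=\tfrac12F_S^*T_SF_S,\qquad H_B=\tfrac12F_B^*T_BF_B,\qquad V=F_S^*\Theta F_B .$$ Let $\omega$ be a quasi-free state on $\mathcal H_B$. For $\tau>0$ put $$L_\tau(\rho)=\mathrm{Tr}_{\mathcal H_B}\Big(e^{-i\tau(H_S+\tau^{-1/2}V+H_B)}(\rho\otimes\omega)\,e^{i\tau(H_S+\tau^{-1/2}V+H_B)}\Big),\qquad \Lambda_\tau(t)=L_\tau^{\lfloor t/\tau\rfloor}.$$ \textbf{Theorem (covariance master equation).} Let $\rho(0)$ be any state on $\mathcal H_S$. For every $t\ge 0$ the limit $\rho(t)=\Lambda^t\rho(0)=\lim_{\tau\to0^+}\Lambda_\tau(t)\rho(0)$ exists. Let $\mathcal M(t)$ be the covariance matrix of $\rho(t)$ and $\mathcal M_B$ that of $\omega$. Then for every $t\ge 0$ (with the one-sided derivative at $t=0$) $$\frac{d\mathcal M(t)}{dt}=-i[T_S,\mathcal M(t)]-\tfrac12\{\Theta\Theta^*,\mathcal M(t)\}+\Theta\,\mathcal M_B\,\Theta^* .$$ -/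

import Mathlib

open scoped Matrix Kronecker ComplexOrder Topology

noncomputable section

namespace FermionBath

/-- Index set of the `2 n` coordinates of the complex phase space of `n` fermionic modes.
In the creation/annihilation basis the coordinates `inl i`, `inr i` correspond to `c_i`, `c_i^*`;
in the Majorana basis they correspond to `γ_i`, `γ_{i+n}`. -/
abbrev Modes (n : ℕ) : Type := Fin n ⊕ Fin n

/-- Occupation numbers `(u_1, …, u_n)`: they label the orthonormal basis `|u_1, …, u_n⟩` of the
antisymmetric Fock space over `ℂ^n`. -/
abbrev Occ (n : ℕ) : Type := Fin n → Bool

/-- Operators on the antisymmetric Fock space over `ℂ^n`, as matrices in the occupation basis. -/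
abbrev FockOp (n : ℕ) : Type := Matrix (Occ n) (Occ n) ℂ

/-- The annihilation operator `c_i`:
`c_i |u⟩ = δ_{u_i,1} ∏_{k<i} (-1)^{u_k} |u_1, …, u_i - 1, …, u_n⟩`. -/
def annihilation {n : ℕ} (i : Fin n) : FockOp n :=
  Matrix.of fun v u =>
    if u i = true ∧ v = Function.update u i false then
      ∏ k ∈ Finset.univ.filter (fun k => k < i), (if u k then (-1 : ℂ) else 1)
    else 0

/-- The parity operator `(-1)^N`. -/
def parity (n : ℕ) : FockOp n :=
  Matrix.diagonal fun u => ∏ k : Fin n, (if u k then (-1 : ℂ) else 1)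

/-- The column operator `F = (c_1, …, c_n, c_1^*, …, c_n^*)^T` in the creation/annihilation
basis. -/
def column (n : ℕ) : Modes n → FockOp n :=
  Sum.elim (fun i => annihilation i) (fun i => (annihilation i)ᴴ)

/-- The Majorana operators `γ_i = c_i + c_i^*`, `γ_{i+n} = -i (c_i - c_i^*)` are obtained from the
column operator by this matrix: `(γ_1, …, γ_{2n})^T = majoranaChange n * F`. -/
def majoranaChange (n : ℕ) : Matrix (Modes n) (Modes n) ℂ :=
  Matrix.fromBlocks 1 1 (-(Complex.I • (1 : Matrix (Fin n) (Fin n) ℂ)))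
    (Complex.I • (1 : Matrix (Fin n) (Fin n) ℂ))

/-- Matrix in the Majorana basis of the phase space operator with matrix `A` in the
creation/annihilation basis. -/
def toMajorana {m n : ℕ} (A : Matrix (Modes m) (Modes n) ℂ) : Matrix (Modes m) (Modes n) ℂ :=
  (1 / 2 : ℂ) • (majoranaChange m * A * (majoranaChange n)ᴴ)

/-- Matrix in the creation/annihilation basis of the phase space operator with matrix `A` in the
Majorana basis. -/
def ofMajorana {m n : ℕ} (A : Matrix (Modes m) (Modes n) ℂ) : Matrix (Modes m) (Modes n) ℂ :=
  (1 / 2 : ℂ) • ((majoranaChange m)ᴴ * A * majoranaChange n)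

/-- The two changes of basis are inverse to each other. -/
theorem toMajorana_ofMajorana {m n : ℕ} (A : Matrix (Modes m) (Modes n) ℂ) :
    toMajorana (ofMajorana A) = A := by
  have h : ∀ k : ℕ, majoranaChange k * (majoranaChange k)ᴴ = (2 : ℂ) • 1 := by
    intro k
    rw [majoranaChange, Matrix.fromBlocks_conjTranspose, Matrix.fromBlocks_multiply,
      ← Matrix.fromBlocks_one, Matrix.fromBlocks_smul]
    congr 1 <;> simp [smul_smul, two_smul]
  have e : majoranaChange m * ((majoranaChange m)ᴴ * A * majoranaChange n) * (majoranaChange n)ᴴ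
      = (majoranaChange m * (majoranaChange m)ᴴ) * A *
        (majoranaChange n * (majoranaChange n)ᴴ) := by
    simp only [Matrix.mul_assoc]
  unfold toMajorana ofMajorana
  rw [Matrix.mul_smul, Matrix.smul_mul, e, h, h, smul_smul]
  rw [Matrix.smul_mul, Matrix.mul_smul, Matrix.one_mul, Matrix.mul_one, smul_smul, smul_smul]
  norm_num

/-- The operator `F^* A G` for columns of operators `F`, `G` and a phase space operator with matrix
`A`, everything in the creation/annihilation basis. -/
def sandwich {m n : ℕ} {ι : Type} [Fintype ι] (F : Modes m → Matrix ι ι ℂ)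
    (A : Matrix (Modes m) (Modes n) ℂ) (G : Modes n → Matrix ι ι ℂ) : Matrix ι ι ℂ :=
  ∑ k, ∑ l, A k l • ((F k)ᴴ * G l)

/-- States (density matrices). -/
def IsState {n : ℕ} (ρ : FockOp n) : Prop := ρ.PosSemidef ∧ ρ.trace = 1

/-- Gaussian states `exp(-β H) / Z` with `H = F^* T F` a (self-adjoint) quadratic Hamiltonian. -/
def IsGaussian {n : ℕ} (ρ : FockOp n) : Prop :=
  ∃ (T : Matrix (Modes n) (Modes n) ℂ) (β : ℝ),
    (sandwich (column n) T (column n)).IsHermitian ∧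
    ρ = (NormedSpace.exp (-((β : ℂ) • sandwich (column n) T (column n)))).trace⁻¹ •
      NormedSpace.exp (-((β : ℂ) • sandwich (column n) T (column n)))

/-- Quasi-free states: limits of Gaussian states. -/
def IsQuasiFree {n : ℕ} (ρ : FockOp n) : Prop := ρ ∈ closure {σ : FockOp n | IsGaussian σ}

/-- The covariance matrix of `ρ`, i.e. the operator `Tr_H ((ρ ⊗ Id) F F^*)` on the phase space
(entries `Tr (ρ c_i c_j^*)`, `Tr (ρ c_i c_j)`, … in the creation/annihilation basis), written in
the Majorana basis. -/
def covarianceMatrix {n : ℕ} (ρ : FockOp n) : Matrix (Modes n) (Modes n) ℂ :=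
  toMajorana (Matrix.of fun k l => (ρ * (column n k * (column n l)ᴴ)).trace)

/-- The two identifications `E_SB`, `E_BS` of the Fock space over `ℂ^L ⊕ ℂ^K` with the tensor
product of the Fock spaces of the system and of the bath. -/
inductive TensorConvention : Type
  | SB
  | BS

/-- Operators on the tensor product of the Fock spaces of system and bath. -/
abbrev JointOp (L K : ℕ) : Type := Matrix (Occ L × Occ K) (Occ L × Occ K) ℂ

/-- The column operator of the system on the tensor product:
`E_SB(c_i^S) = c_i^S ⊗ Id` and `E_BS(c_i^S) = c_i^S ⊗ (-1)^{N_B}`. -/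
def systemColumn (L K : ℕ) : TensorConvention → Modes L → JointOp L K
  | .SB, k => column L k ⊗ₖ (1 : FockOp K)
  | .BS, k => column L k ⊗ₖ parity K

/-- The column operator of the bath on the tensor product:
`E_SB(c_i^B) = (-1)^{N_S} ⊗ c_i^B` and `E_BS(c_i^B) = Id ⊗ c_i^B`. -/
def bathColumn (L K : ℕ) : TensorConvention → Modes K → JointOp L K
  | .SB, k => parity L ⊗ₖ column K k
  | .BS, k => (1 : FockOp L) ⊗ₖ column K k

/-- The quadratic Hamiltonian `(1/2) F^* T F`, where `T` is given in the Majorana basis. -/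
def hamiltonian {n : ℕ} (T : Matrix (Modes n) (Modes n) ℂ) : FockOp n :=
  (1 / 2 : ℂ) • sandwich (column n) (ofMajorana T) (column n)

/-- The interaction `V = F_S^* Θ F_B`, where `Θ` is given in the Majorana basis. -/
def interaction {L K : ℕ} (e : TensorConvention) (Θ : Matrix (Modes L) (Modes K) ℂ) :
    JointOp L K :=
  sandwich (systemColumn L K e) (ofMajorana Θ) (bathColumn L K e)

/-- The Hamiltonian `H_S + λ V + H_B`. -/
def totalHamiltonian {L K : ℕ} (e : TensorConvention) (TS : Matrix (Modes L) (Modes L) ℂ)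
    (TB : Matrix (Modes K) (Modes K) ℂ) (Θ : Matrix (Modes L) (Modes K) ℂ) (lam : ℝ) :
    JointOp L K :=
  hamiltonian TS ⊗ₖ (1 : FockOp K) + (lam : ℂ) • interaction e Θ +
    (1 : FockOp L) ⊗ₖ hamiltonian TB

/-- Partial trace over the bath. -/
def traceBath {L K : ℕ} (X : JointOp L K) : FockOp L :=
  Matrix.of fun u v => ∑ b, X (u, b) (v, b)

/-- One interaction of duration `τ`, with coupling `λ = 1/√τ`:
`L_τ(ρ) = Tr_B (exp(-iτ(H_S + λV + H_B)) (ρ ⊗ ω) exp(iτ(H_S + λV + H_B)))`. -/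
def interactionStep {L K : ℕ} (e : TensorConvention) (TS : Matrix (Modes L) (Modes L) ℂ)
    (TB : Matrix (Modes K) (Modes K) ℂ) (Θ : Matrix (Modes L) (Modes K) ℂ) (ω : FockOp K)
    (τ : ℝ) (ρ : FockOp L) : FockOp L :=
  traceBath
    (NormedSpace.exp (-(Complex.I * (τ : ℂ)) • totalHamiltonian e TS TB Θ (1 / √τ)) *
      (ρ ⊗ₖ ω) *
      NormedSpace.exp ((Complex.I * (τ : ℂ)) • totalHamiltonian e TS TB Θ (1 / √τ)))

/-- The repeated interaction evolution `Λ_τ(t) = L_τ^⌊t/τ⌋`. -/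
def repeatedEvolution {L K : ℕ} (e : TensorConvention) (TS : Matrix (Modes L) (Modes L) ℂ)
    (TB : Matrix (Modes K) (Modes K) ℂ) (Θ : Matrix (Modes L) (Modes K) ℂ) (ω : FockOp K)
    (τ t : ℝ) (ρ : FockOp L) : FockOp L :=
  (interactionStep e TS TB Θ ω τ)^[⌊t / τ⌋₊] ρ

/-- The continuous limit `Λ^t(ρ) = lim_{τ → 0+} Λ_τ(t)(ρ)`. -/
def limitEvolution {L K : ℕ} (e : TensorConvention) (TS : Matrix (Modes L) (Modes L) ℂ)
    (TB : Matrix (Modes K) (Modes K) ℂ) (Θ : Matrix (Modes L) (Modes K) ℂ) (ω : FockOp K)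
    (t : ℝ) (ρ : FockOp L) : FockOp L :=
  Filter.limUnder (𝓝[>] (0 : ℝ)) fun τ => repeatedEvolution e TS TB Θ ω τ t ρ

/-- The matrix `i R` for a real matrix `R`. -/
def imaginary {m n : ℕ} (R : Matrix (Modes m) (Modes n) ℝ) : Matrix (Modes m) (Modes n) ℂ :=
  Complex.I • R.map Complex.ofReal

end FermionBath

end

/-! With coupling `1/√τ` the exponent of one step is `√τ a + τ h`, where `a = iV` and `h = i(H_S +
H_B)`. Expanding the conjugation to second order in `s = √τ` gives a step of the form `1 + s (first
order) + s² G + o(s²)`. Quasi-free states are even and `V` is odd in the bath, so the partial trace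
kills the first order term. Hence the step is `1 + τ G + o(τ)`, and its `⌊t/τ⌋`-th power tends to
`exp(tG)` (`exists_flow`, resting on `HasExpansion.exp` and `tendsto_pow_floor_exp`).

The equation for the covariances comes from the Heisenberg picture: cyclicity of the trace moves the
commutators in `G` onto products `γ_a γ_b` (`trace_commutators_mul`). By the anticommutation
relations, `[h, ·]` acts on the system Majorana operators as the matrix `r`, while `[iV, ·]` sends
system operators to bath operators by `w` and back by `-wᵀ`. The double commutator of `γ_a γ_b` is
therefore again quadratic: hitting one factor twice gives the damping `w wᵀ`, hitting each factor
once gives the bath term (`double_commutator_bilinear`). So the equation closes on covariances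
(`covarianceMatrix_generator`). With `T_S = i r` and `Θ = i w` it is the stated one. -/

open scoped Matrix Kronecker ComplexOrder Topology

noncomputable section

namespace FermionBath

open Filter Asymptotics

/-! ### Powers of near-identity families in a Banach algebra -/

section Banach

variable {A : Type*} [NormedRing A] [NormOneClass A]

theorem norm_pow_sub_pow_le {x y : A} {r : ℝ} (hr : 1 ≤ r) (hx : ‖x‖ ≤ r) (hy : ‖y‖ ≤ r)
    (n : ℕ) : ‖x ^ n - y ^ n‖ ≤ n * r ^ n * ‖x - y‖ := by
  induction n with
  | zero => simp
  | succ n ih =>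
    have hxn : ‖x ^ n‖ ≤ r ^ n := (norm_pow_le x n).trans (by gcongr)
    have hrn : r ^ n ≤ r ^ (n + 1) := pow_le_pow_right₀ hr n.le_succ
    calc ‖x ^ (n + 1) - y ^ (n + 1)‖ = ‖x ^ n * (x - y) + (x ^ n - y ^ n) * y‖ := by
          congr 1; simp only [pow_succ, mul_sub, sub_mul]; abel
      _ ≤ ‖x ^ n‖ * ‖x - y‖ + ‖x ^ n - y ^ n‖ * ‖y‖ :=
          (norm_add_le _ _).trans (add_le_add (norm_mul_le _ _) (norm_mul_le _ _))
      _ ≤ r ^ (n + 1) * ‖x - y‖ + (n * r ^ n * ‖x - y‖) * r := by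
          gcongr; exact hxn.trans hrn
      _ = ((n + 1 : ℕ) : ℝ) * r ^ (n + 1) * ‖x - y‖ := by push_cast; ring

theorem tendsto_floor_div_mul {t : ℝ} (ht : 0 ≤ t) :
    Tendsto (fun τ : ℝ => (⌊t / τ⌋₊ : ℝ) * τ) (𝓝[>] 0) (𝓝 t) := by
  have h : Tendsto (fun τ : ℝ => t - τ) (𝓝[>] 0) (𝓝 t) := by
    have : Tendsto (fun τ : ℝ => t - τ) (𝓝 0) (𝓝 (t - 0)) :=
      Continuous.tendsto (by fun_prop) 0
    simpa using this.mono_left nhdsWithin_le_nhds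
  refine tendsto_of_tendsto_of_tendsto_of_le_of_le' h tendsto_const_nhds ?_ ?_
  · filter_upwards [self_mem_nhdsWithin] with τ (hτ : 0 < τ)
    have := mul_lt_mul_of_pos_right (Nat.lt_floor_add_one (t / τ)) hτ
    rw [div_mul_cancel₀ _ hτ.ne'] at this
    linarith
  · filter_upwards [self_mem_nhdsWithin] with τ (hτ : 0 < τ)
    have := mul_le_mul_of_nonneg_right (Nat.floor_le (div_nonneg ht hτ.le)) hτ.le
    rwa [div_mul_cancel₀ _ hτ.ne'] at this

variable [NormedAlgebra ℝ A]

/-- The extra `1` in the exponent absorbs the `o(τ)` remainder. The exponential form keeps the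
`⌊t/τ⌋`-th power bounded uniformly in `τ`. -/
theorem eventually_norm_le_exp {S : ℝ → A} {G : A}
    (hS : (fun τ => S τ - (1 + τ • G)) =o[𝓝[>] 0] fun τ : ℝ => τ) :
    ∀ᶠ τ in 𝓝[>] (0 : ℝ), ‖S τ‖ ≤ Real.exp (τ * (‖G‖ + 1)) := by
  filter_upwards [hS.bound one_pos, self_mem_nhdsWithin] with τ h (hτ : 0 < τ)
  have h1 : ‖S τ‖ ≤ ‖S τ - (1 + τ • G)‖ + (‖(1 : A)‖ + ‖τ • G‖) :=
    calc ‖S τ‖ = ‖(S τ - (1 + τ • G)) + (1 + τ • G)‖ := by rw [sub_add_cancel]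
      _ ≤ _ := (norm_add_le _ _).trans (by gcongr; exact norm_add_le _ _)
  rw [norm_one, norm_smul, Real.norm_of_nonneg hτ.le] at h1
  rw [Real.norm_of_nonneg hτ.le] at h
  have := Real.add_one_le_exp (τ * (‖G‖ + 1))
  linarith

variable [CompleteSpace A]

theorem exp_smul_sub_isLittleO {A : Type*} [NormedRing A] [NormedAlgebra ℝ A] [CompleteSpace A]
    (G : A) :
    (fun τ : ℝ => NormedSpace.exp (τ • G) - (1 + τ • G)) =o[𝓝[>] 0] fun τ : ℝ => τ := by
  have h := (hasDerivAt_exp_smul_const (𝕂 := ℝ) G (0 : ℝ)).isLittleO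
  refine (h.mono nhdsWithin_le_nhds).congr (fun τ => ?_) fun τ => by simp
  simp [sub_sub]

/-- Powers of a family with derivative `G` at `0` converge to the semigroup generated by `G`. -/
theorem tendsto_pow_floor_exp {S : ℝ → A} {G : A}
    (hS : (fun τ => S τ - (1 + τ • G)) =o[𝓝[>] 0] fun τ : ℝ => τ) {t : ℝ} (ht : 0 ≤ t) :
    Tendsto (fun τ : ℝ => S τ ^ ⌊t / τ⌋₊) (𝓝[>] 0) (𝓝 (NormedSpace.exp (t • G))) := by
  have hE := exp_smul_sub_isLittleO G
  have hd : (fun τ => S τ - NormedSpace.exp (τ • G)) =o[𝓝[>] 0] fun τ : ℝ => τ :=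
    (hS.sub hE).congr_left fun τ => by abel
  -- Consistency plus stability: at most `t/τ` factors, each replaced at cost `o(τ)`, with bounded
  -- products in between.
  have hdiff : Tendsto (fun τ : ℝ => S τ ^ ⌊t / τ⌋₊ - NormedSpace.exp (τ • G) ^ ⌊t / τ⌋₊)
      (𝓝[>] 0) (𝓝 0) := by
    have h0 : Tendsto (fun τ : ℝ => t * Real.exp (t * (‖G‖ + 1)) *
        (‖S τ - NormedSpace.exp (τ • G)‖ / τ)) (𝓝[>] 0) (𝓝 0) := by
      have := hd.norm_left.tendsto_div_nhds_zero.const_mul (t * Real.exp (t * (‖G‖ + 1)))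
      simpa using this
    refine squeeze_zero_norm' ?_ h0
    filter_upwards [eventually_norm_le_exp hS, eventually_norm_le_exp hE, self_mem_nhdsWithin]
      with τ h1 h2 (hτ : 0 < τ)
    have hn : (⌊t / τ⌋₊ : ℝ) ≤ t / τ := Nat.floor_le (div_nonneg ht hτ.le)
    have hg : 0 ≤ ‖G‖ + 1 := by positivity
    have hpow : Real.exp (τ * (‖G‖ + 1)) ^ ⌊t / τ⌋₊ ≤ Real.exp (t * (‖G‖ + 1)) := by
      rw [← Real.exp_nat_mul, Real.exp_le_exp, ← mul_assoc]
      refine mul_le_mul_of_nonneg_right ?_ hg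
      rwa [le_div_iff₀ hτ] at hn
    refine (norm_pow_sub_pow_le (Real.one_le_exp (by positivity)) h1 h2 _).trans ?_
    calc _ ≤ t / τ * Real.exp (t * (‖G‖ + 1)) * ‖S τ - NormedSpace.exp (τ • G)‖ := by gcongr
      _ = _ := by ring
  have hexp : Tendsto (fun τ : ℝ => NormedSpace.exp (τ • G) ^ ⌊t / τ⌋₊) (𝓝[>] 0)
      (𝓝 (NormedSpace.exp (t • G))) := by
    have hc : Continuous fun u : ℝ => NormedSpace.exp (u • G) :=
      continuous_iff_continuousAt.2 fun u =>
        (hasDerivAt_exp_smul_const (𝕂 := ℝ) G u).continuousAt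
    refine ((hc.tendsto t).comp (tendsto_floor_div_mul ht)).congr fun τ => ?_
    let _ : NormedAlgebra ℚ A := NormedAlgebra.restrictScalars ℚ ℝ A
    rw [Function.comp_apply, ← NormedSpace.exp_nsmul, ← Nat.cast_smul_eq_nsmul ℝ, smul_smul]
  simpa using hdiff.add hexp

end Banach

/-! ### Second order expansions at `0+` -/

section Expansion

/-- `f s = a + s b + s² c + o(s²)` as `s → 0+`. -/
def HasExpansion {E : Type*} [NormedAddCommGroup E] [NormedSpace ℝ E] (f : ℝ → E)
    (a b c : E) : Prop :=
  (fun s : ℝ => f s - (a + s • b + s ^ 2 • c)) =o[𝓝[>] 0] fun s : ℝ => s ^ 2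

variable {E F H : Type*} [NormedAddCommGroup E] [NormedSpace ℝ E] [NormedAddCommGroup F]
  [NormedSpace ℝ F] [NormedAddCommGroup H] [NormedSpace ℝ H]

theorem HasExpansion.isBigO_one {f : ℝ → E} {a b c : E} (hf : HasExpansion f a b c) :
    f =O[𝓝[>] 0] fun _ : ℝ => (1 : ℝ) := by
  have h1 : (fun s : ℝ => s ^ 2) =O[𝓝[>] 0] fun _ : ℝ => (1 : ℝ) :=
    ((continuous_pow 2).tendsto (0 : ℝ)).isBigO_one ℝ |>.mono nhdsWithin_le_nhds
  have hp : Continuous fun s : ℝ => a + s • b + s ^ 2 • c := by fun_prop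
  have h2 := ((hp.tendsto 0).isBigO_one ℝ).mono (nhdsWithin_le_nhds (s := Set.Ioi 0))
  exact ((hf.isBigO.trans h1).add h2).congr_left fun s => by simp

theorem HasExpansion.map {f : ℝ → E} {a b c : E} (hf : HasExpansion f a b c) (T : E →L[ℝ] F) :
    HasExpansion (fun s => T (f s)) (T a) (T b) (T c) :=
  ((T.isBigO_comp (fun s : ℝ => f s - (a + s • b + s ^ 2 • c)) (𝓝[>] 0)).trans_isLittleO
    hf).congr_left fun s => by simp

/-- With `p`, `q` the quadratic polynomials of `f`, `g`, the error is `B(f - p, g) + B(p, g - q)`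
plus the terms of degree 3 and 4 in `B(p, q)`. -/
theorem HasExpansion.bilinear (B : E →L[ℝ] F →L[ℝ] H) {f : ℝ → E} {g : ℝ → F} {a b c : E}
    {a' b' c' : F} (hf : HasExpansion f a b c) (hg : HasExpansion g a' b' c') :
    HasExpansion (fun s => B (f s) (g s)) (B a a') (B a b' + B b a')
      (B a c' + B b b' + B c a') := by
  have hB : ∀ (u : ℝ → E) (v : ℝ → F),
      (fun s => B (u s) (v s)) =O[𝓝[>] 0] fun s => ‖u s‖ * ‖v s‖ := fun u v =>
    IsBigO.of_bound ‖B‖ (Eventually.of_forall fun s => by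
      simpa [mul_assoc] using B.le_opNorm₂ (u s) (v s))
  have hp : HasExpansion (fun s : ℝ => a + s • b + s ^ 2 • c) a b c := by
    simp only [HasExpansion, sub_self]; exact isLittleO_zero _ _
  have h1 : (fun s => B (f s - (a + s • b + s ^ 2 • c)) (g s)) =o[𝓝[>] 0]
      fun s : ℝ => s ^ 2 :=
    (hB _ _).trans_isLittleO
      ((hf.norm_left.mul_isBigO hg.isBigO_one.norm_left).congr_right fun s => mul_one _)
  have h2 : (fun s : ℝ => B (a + s • b + s ^ 2 • c) (g s - (a' + s • b' + s ^ 2 • c')))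
      =o[𝓝[>] 0] fun s : ℝ => s ^ 2 :=
    (hB _ _).trans_isLittleO
      ((hp.isBigO_one.norm_left.mul_isLittleO hg.norm_left).congr_right fun s => one_mul _)
  have h3 : (fun s : ℝ => s ^ 3 • (B b c' + B c b' + s • B c c')) =o[𝓝[>] 0]
      fun s : ℝ => s ^ 2 := by
    have hq : Continuous fun s : ℝ => B b c' + B c b' + s • B c c' := by fun_prop
    have hq' := ((hq.tendsto 0).isBigO_one ℝ).mono (nhdsWithin_le_nhds (s := Set.Ioi 0))
    have h32 : (fun s : ℝ => s ^ 3) =o[𝓝[>] 0] fun s : ℝ => s ^ 2 :=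
      (isLittleO_pow_pow (by norm_num)).mono nhdsWithin_le_nhds
    exact (h32.smul_isBigO hq').congr_right fun s => by simp
  refine ((h1.add h2).add h3).congr_left fun s => ?_
  simp only [map_sub, map_add, map_smul, sub_apply, add_apply,
    smul_apply]
  module

/-- The argument is `O(s)`, so cutting the exponential series after the quadratic term costs
`O(s³)`. The quadratic term leaves a further `s³` remainder, `h3`. -/
theorem HasExpansion.exp {A : Type*} [NormedRing A] [NormedAlgebra ℝ A] [CompleteSpace A]
    (a h : A) :
    HasExpansion (fun s : ℝ => NormedSpace.exp (s • a + s ^ 2 • h)) 1 a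
      (h + (1 / 2 : ℝ) • (a * a)) := by
  have hx : Continuous fun s : ℝ => s • a + s ^ 2 • h := by fun_prop
  have hx0 : Tendsto (fun s : ℝ => s • a + s ^ 2 • h) (𝓝[>] 0) (𝓝 0) := by
    simpa using (hx.tendsto 0).mono_left nhdsWithin_le_nhds
  have hxO : (fun s : ℝ => s • a + s ^ 2 • h) =O[𝓝[>] 0] fun s : ℝ => s := by
    have hq : Continuous fun s : ℝ => a + s • h := by fun_prop
    have hq' := ((hq.tendsto 0).isBigO_one ℝ).mono (nhdsWithin_le_nhds (s := Set.Ioi 0))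
    refine ((isBigO_refl (fun s : ℝ => s) _).smul hq').congr (fun s => ?_) fun s => by simp
    module
  have h1 := (NormedSpace.exp_hasFPowerSeriesAt_zero (𝕂 := ℝ)
    (𝔸 := A)).isBigO_sub_partialSum_pow 3
  have h2 := (h1.comp_tendsto hx0).trans (hxO.norm_left.pow 3)
  have h32 : (fun s : ℝ => s ^ 3) =o[𝓝[>] 0] fun s : ℝ => s ^ 2 :=
    (isLittleO_pow_pow (by norm_num)).mono nhdsWithin_le_nhds
  have h3 : (fun s : ℝ => s ^ 3 • ((1 / 2 : ℝ) • (a * h + h * a + s • (h * h)))) =o[𝓝[>] 0]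
      fun s : ℝ => s ^ 2 := by
    have hq : Continuous fun s : ℝ => (1 / 2 : ℝ) • (a * h + h * a + s • (h * h)) := by
      fun_prop
    have hq' := ((hq.tendsto 0).isBigO_one ℝ).mono (nhdsWithin_le_nhds (s := Set.Ioi 0))
    exact (h32.smul_isBigO hq').congr_right fun s => by simp
  refine ((h2.trans_isLittleO h32).add h3).congr_left fun s => ?_
  simp only [Function.comp_apply, zero_add, FormalMultilinearSeries.partialSum,
    Finset.sum_range_succ, Finset.sum_range_zero, NormedSpace.expSeries_apply_eq,
    Nat.factorial, pow_zero, pow_one, sq (s • a + s ^ 2 • h), mul_add, add_mul, smul_mul_assoc,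
    mul_smul_comm]
  norm_num
  module

end Expansion

/-! ### Majorana operators, anticommutation relations and parity -/

section Majorana

variable {n : ℕ}

/-- The Majorana operators belonging to a column of operators. -/
def majorana {ι : Type} (F : Modes n → Matrix ι ι ℂ) (k : Modes n) : Matrix ι ι ℂ :=
  ∑ j, majoranaChange n k j • F j

theorem majorana_inl {ι : Type} (F : Modes n → Matrix ι ι ℂ) (i : Fin n) :
    majorana F (Sum.inl i) = F (Sum.inl i) + F (Sum.inr i) := by
  simp [majorana, majoranaChange, Matrix.one_apply]

theorem majorana_inr {ι : Type} (F : Modes n → Matrix ι ι ℂ) (i : Fin n) :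
    majorana F (Sum.inr i) = -(Complex.I • F (Sum.inl i)) + Complex.I • F (Sum.inr i) := by
  simp [majorana, majoranaChange, Matrix.one_apply]

theorem sandwich_ofMajorana {m : ℕ} {ι : Type} [Fintype ι] (F : Modes m → Matrix ι ι ℂ)
    (A : Matrix (Modes m) (Modes n) ℂ) (G : Modes n → Matrix ι ι ℂ) :
    sandwich F (ofMajorana A) G =
      (1 / 2 : ℂ) • ∑ k, ∑ l, A k l • ((majorana F k)ᴴ * majorana G l) := by
  -- The common summand: the two sides differ only in the order of the four sums.
  let f : Modes m → Modes n → Modes m → Modes n → Matrix ι ι ℂ := fun p q k l =>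
    (1 / 2 * (star (majoranaChange m p k) * A p q * majoranaChange n q l) : ℂ) • ((F k)ᴴ * G l)
  have hl : sandwich F (ofMajorana A) G = ∑ k, ∑ l, ∑ q, ∑ p, f p q k l := by
    simp only [sandwich, ofMajorana, Matrix.smul_apply, Matrix.mul_apply, Finset.sum_mul,
      smul_eq_mul, Matrix.conjTranspose_apply, Finset.mul_sum, Finset.sum_smul, f]
  have hr : (1 / 2 : ℂ) • ∑ k, ∑ l, A k l • ((majorana F k)ᴴ * majorana G l) =
      ∑ p, ∑ q, ∑ k, ∑ l, f p q k l := by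
    simp only [majorana, Matrix.conjTranspose_sum, Matrix.conjTranspose_smul, Finset.sum_mul,
      Finset.smul_sum, smul_mul_assoc, smul_smul]
    refine Finset.sum_congr rfl fun p _ => Finset.sum_congr rfl fun q _ =>
      Finset.sum_congr rfl fun k _ => ?_
    simp only [Finset.mul_sum, Finset.smul_sum, mul_smul_comm, smul_smul, f]
    refine Finset.sum_congr rfl fun l _ => ?_
    congr 1; ring
  have hk : ∀ k, ∑ l, ∑ q, ∑ p, f p q k l = ∑ p, ∑ q, ∑ l, f p q k l := fun k => by
    rw [Finset.sum_comm]
    simp_rw [Finset.sum_comm (s := (Finset.univ : Finset (Modes n)))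
      (t := (Finset.univ : Finset (Modes m)))]
  rw [hl, hr, Finset.sum_congr rfl fun k _ => hk k, Finset.sum_comm]
  exact Finset.sum_congr rfl fun p _ => Finset.sum_comm

theorem toMajorana_trace {ι : Type} [Fintype ι] (ρ : Matrix ι ι ℂ) (F : Modes n → Matrix ι ι ℂ) :
    toMajorana (Matrix.of fun k l => (ρ * (F k * (F l)ᴴ)).trace) =
      Matrix.of fun k l => (1 / 2 : ℂ) * (ρ * (majorana F k * (majorana F l)ᴴ)).trace := by
  ext k l
  simp only [toMajorana, Matrix.smul_apply, Matrix.mul_apply (M := _ * _), Matrix.mul_apply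
    (M := majoranaChange n), Matrix.of_apply, majorana, Matrix.conjTranspose_sum,
    Matrix.conjTranspose_smul, Finset.mul_sum, Finset.sum_mul, smul_mul_assoc, mul_smul_comm,
    Matrix.trace_sum, Matrix.trace_smul, smul_eq_mul, Matrix.conjTranspose_apply]
  refine Finset.sum_congr rfl fun i _ => Finset.sum_congr rfl fun j _ => ?_
  ring

/-- The occupation numbers with the `i`-th one changed. -/
def flip (i : Fin n) (u : Occ n) : Occ n := Function.update u i (!u i)

/-- The sign `∏_{k<i} (-1)^{u_k}`. -/
def stringSign (i : Fin n) (u : Occ n) : ℂ :=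
  ∏ k ∈ Finset.univ.filter (fun k => k < i), (if u k then (-1 : ℂ) else 1)

/-- The coefficient of `γ_k |u⟩`. -/
def majoranaSign : Modes n → Occ n → ℂ
  | .inl i, u => stringSign i u
  | .inr i, u => stringSign i u * (if u i then -Complex.I else Complex.I)

/-- The mode on which `γ_k` acts. -/
def site : Modes n → Fin n := Sum.elim id id

theorem flip_flip (i : Fin n) (u : Occ n) : flip i (flip i u) = u := by
  simp [flip]

theorem flip_comm (i j : Fin n) (u : Occ n) : flip i (flip j u) = flip j (flip i u) := by
  by_cases h : i = j
  · rw [h]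
  · simp only [flip, Function.update_of_ne h, Function.update_of_ne (Ne.symm h)]
    exact (Function.update_comm h _ _ _).symm

/-- The string of `i` sees only modes strictly below `i`. This asymmetry is the source of
anticommutation between different modes. -/
theorem stringSign_flip (i j : Fin n) (u : Occ n) :
    stringSign i (flip j u) = if j < i then -stringSign i u else stringSign i u := by
  split_ifs with h
  · have hj : j ∈ Finset.univ.filter (fun k => k < i) := by simpa using h
    rw [stringSign, stringSign, ← Finset.mul_prod_erase _ _ hj, ← Finset.mul_prod_erase _ _ hj,
      ← neg_mul]
    congr 1
    · cases hu : u j <;> simp [flip, hu]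
    · refine Finset.prod_congr rfl fun k hk => ?_
      rw [flip, Function.update_of_ne (Finset.ne_of_mem_erase hk)]
  · refine Finset.prod_congr rfl fun k hk => ?_
    rw [flip, Function.update_of_ne]
    rintro rfl
    exact h (by simpa using hk)

theorem stringSign_mul_self (i : Fin n) (u : Occ n) : stringSign i u * stringSign i u = 1 := by
  rw [stringSign, ← Finset.prod_mul_distrib]
  exact Finset.prod_eq_one fun k _ => by split_ifs <;> norm_num

theorem annihilation_apply (i : Fin n) (v u : Occ n) :
    annihilation i v u = if u i = true ∧ v = flip i u then stringSign i u else 0 := by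
  simp only [annihilation, Matrix.of_apply, stringSign, flip]
  refine if_congr (and_congr_right fun h => by rw [h, Bool.not_true]) rfl rfl

theorem star_stringSign (i : Fin n) (u : Occ n) : star (stringSign i u) = stringSign i u := by
  rw [stringSign, star_prod]
  exact Finset.prod_congr rfl fun k _ => by split_ifs <;> simp

theorem eq_flip_comm {i : Fin n} {u v : Occ n} : v = flip i u ↔ u = flip i v :=
  ⟨fun h => by rw [h, flip_flip], fun h => by rw [h, flip_flip]⟩

theorem conjTranspose_annihilation_apply (i : Fin n) (v u : Occ n) :
    (annihilation i)ᴴ v u = if u i = false ∧ v = flip i u then stringSign i u else 0 := by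
  rw [Matrix.conjTranspose_apply, annihilation_apply]
  by_cases h : v = flip i u
  · subst h
    have : flip i u i = !u i := by simp [flip]
    rw [flip_flip, this, stringSign_flip]
    cases u i <;> simp [star_stringSign]
  · rw [if_neg, if_neg, star_zero]
    · exact fun h' => h h'.2
    · exact fun h' => h (eq_flip_comm.1 h'.2)

/-- `c_i` and `c_i^*` act on complementary halves of the basis by the same flip, so their
combination is a permutation with phases. Products then have a single entry per column. -/
theorem majorana_column_apply (k : Modes n) (v u : Occ n) :
    majorana (column n) k v u = if v = flip (site k) u then majoranaSign k u else 0 := by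
  rcases k with i | i
  · rw [majorana_inl, Matrix.add_apply]
    simp only [column, Sum.elim_inl, Sum.elim_inr, annihilation_apply,
      conjTranspose_annihilation_apply, site, majoranaSign, id]
    by_cases hv : v = flip i u <;> cases u i <;> simp [hv]
  · rw [majorana_inr, Matrix.add_apply, Matrix.neg_apply, Matrix.smul_apply, Matrix.smul_apply]
    simp only [column, Sum.elim_inl, Sum.elim_inr, annihilation_apply,
      conjTranspose_annihilation_apply, site, majoranaSign, id]
    by_cases hv : v = flip i u <;> cases u i <;> simp [hv, mul_comm]

theorem majorana_mul_apply (k l : Modes n) (v u : Occ n) :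
    (majorana (column n) k * majorana (column n) l) v u =
      if v = flip (site k) (flip (site l) u) then
        majoranaSign k (flip (site l) u) * majoranaSign l u else 0 := by
  rw [Matrix.mul_apply, Finset.sum_eq_single (flip (site l) u)]
  · simp [majorana_column_apply]
  · intro w _ hw
    simp [majorana_column_apply, hw]
  · simp

theorem majoranaSign_flip_of_ne {k l : Modes n} (h : site k ≠ site l) (u : Occ n) :
    majoranaSign k (flip (site l) u) =
      if site l < site k then -majoranaSign k u else majoranaSign k u := by
  rcases k with i | i
  · exact stringSign_flip i (site l) u
  · have hi : flip (site l) u i = u i := Function.update_of_ne h _ _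
    change stringSign i _ * _ = if site l < i then -(stringSign i u * _) else stringSign i u * _
    rw [hi, stringSign_flip]
    split_ifs <;> ring

/-- The canonical anticommutation relations. -/
theorem majorana_anticomm (k l : Modes n) :
    majorana (column n) k * majorana (column n) l + majorana (column n) l * majorana (column n) k
      = if k = l then 2 else 0 := by
  have hI : Complex.I * Complex.I = -1 := Complex.I_mul_I
  ext v u
  rw [Matrix.add_apply, majorana_mul_apply, majorana_mul_apply,
    flip_comm (site l) (site k)]
  by_cases hs : site k = site l
  · have h2 : ∀ w, (2 : FockOp n) w u = if w = u then 2 else 0 := by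
      intro w
      rw [← Nat.cast_ofNat, ← Matrix.diagonal_natCast, Matrix.diagonal_apply]; simp
    have hsq := fun i => stringSign_mul_self i u
    rcases k with i | i <;> rcases l with j | j <;> obtain rfl : i = j := hs
    all_goals
      have hf : flip i u i = !u i := by simp [flip]
      by_cases hv : v = u <;>
        simp only [site, Sum.elim_inl, Sum.elim_inr, id, flip_flip, hv, if_true, if_false,
          majoranaSign, stringSign_flip, lt_irrefl, hf, reduceCtorEq, h2, Matrix.zero_apply,
          add_zero]
    · linear_combination 2 * hsq i
    · cases u i <;> simp <;> ring
    · cases u i <;> simp <;> ring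
    · cases u i <;> simp <;> linear_combination (-2 * stringSign i u * stringSign i u) * hI
        + 2 * hsq i
  -- On different sites exactly one of the two orders picks up a sign, namely the one where the
  -- lower site is flipped first.
  · have hkl : k ≠ l := fun h => hs (by rw [h])
    rw [if_neg hkl, majoranaSign_flip_of_ne hs, majoranaSign_flip_of_ne (Ne.symm hs),
      Matrix.zero_apply]
    rcases lt_or_gt_of_ne hs with h | h
    · simp only [h, h.not_gt, if_true, if_false]; split_ifs <;> ring
    · simp only [gt_iff_lt.1 h, (gt_iff_lt.1 h).not_gt, if_true, if_false]; split_ifs <;> ring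

theorem majorana_isHermitian (k : Modes n) :
    (majorana (column n) k)ᴴ = majorana (column n) k := by
  rcases k with i | i
  · rw [majorana_inl]; simp [column, add_comm]
  · rw [majorana_inr]; simp [column, add_comm]

theorem parity_mul_self : parity n * parity n = 1 := by
  rw [parity, Matrix.diagonal_mul_diagonal, ← Matrix.diagonal_one]
  congr 1; ext u
  rw [← Finset.prod_mul_distrib]
  exact Finset.prod_eq_one fun k _ => by split_ifs <;> norm_num

theorem parity_conjTranspose : (parity n)ᴴ = parity n := by
  rw [parity, Matrix.diagonal_conjTranspose]
  congr 1; ext u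
  rw [Pi.star_apply, star_prod]
  exact Finset.prod_congr rfl fun k _ => by split_ifs <;> simp

theorem prod_sign_flip (i : Fin n) (u : Occ n) :
    ∏ k, (if flip i u k then (-1 : ℂ) else 1) = -∏ k, (if u k then (-1 : ℂ) else 1) := by
  rw [← Finset.mul_prod_erase _ _ (Finset.mem_univ i),
    ← Finset.mul_prod_erase _ _ (Finset.mem_univ i), ← neg_mul]
  congr 1
  · cases hu : u i <;> simp [flip, hu]
  · refine Finset.prod_congr rfl fun k hk => ?_
    rw [flip, Function.update_of_ne (Finset.ne_of_mem_erase hk)]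

theorem parity_mul_annihilation (i : Fin n) :
    parity n * annihilation i = -(annihilation i * parity n) := by
  ext v u
  rw [parity, Matrix.neg_apply, Matrix.diagonal_mul, Matrix.mul_diagonal, annihilation_apply]
  split_ifs with h
  · rw [h.2, prod_sign_flip]; ring
  · simp

theorem parity_mul_column (k : Modes n) :
    parity n * column n k = -(column n k * parity n) := by
  rcases k with i | i
  · exact parity_mul_annihilation i
  · have := congrArg Matrix.conjTranspose (parity_mul_annihilation i)
    rw [Matrix.conjTranspose_neg, Matrix.conjTranspose_mul, Matrix.conjTranspose_mul,
      parity_conjTranspose] at this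
    simp only [column, Sum.elim_inr]
    rw [this, neg_neg]

theorem parity_mul_majorana (k : Modes n) :
    parity n * majorana (column n) k = -(majorana (column n) k * parity n) := by
  simp only [majorana, Finset.mul_sum, Finset.sum_mul, mul_smul_comm, smul_mul_assoc,
    parity_mul_column, smul_neg, Finset.sum_neg_distrib]

theorem covarianceMatrix_apply (ρ : FockOp n) (k l : Modes n) :
    covarianceMatrix ρ k l =
      (1 / 2 : ℂ) * (ρ * (majorana (column n) k * majorana (column n) l)).trace := by
  rw [covarianceMatrix, toMajorana_trace, Matrix.of_apply, majorana_isHermitian]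

theorem parity_commute_sandwich (T : Matrix (Modes n) (Modes n) ℂ) :
    Commute (parity n) (sandwich (column n) T (column n)) := by
  refine Commute.sum_right _ _ _ fun k _ => Commute.sum_right _ _ _ fun l _ =>
    Commute.smul_right ?_ _
  have h := congrArg Matrix.conjTranspose (parity_mul_column k)
  rw [Matrix.conjTranspose_neg, Matrix.conjTranspose_mul, Matrix.conjTranspose_mul,
    parity_conjTranspose] at h
  have h' : parity n * (column n k)ᴴ = -((column n k)ᴴ * parity n) := by rw [h, neg_neg]
  rw [Commute, SemiconjBy, ← mul_assoc, h', neg_mul, mul_assoc, parity_mul_column, mul_neg,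
    neg_neg, mul_assoc]

/-- Quasi-free states are even. -/
theorem IsQuasiFree.parity_comm {ω : FockOp n} (h : IsQuasiFree ω) :
    parity n * ω = ω * parity n := by
  -- Commuting with parity is a closed condition, so it passes from Gaussian states to their limits.
  have hcl : IsClosed {σ : FockOp n | parity n * σ = σ * parity n} :=
    isClosed_eq (by fun_prop) (by fun_prop)
  refine closure_minimal ?_ hcl h
  rintro σ ⟨T, β, -, rfl⟩
  exact ((((parity_commute_sandwich T).smul_right (β : ℂ)).neg_right).exp_right).smul_right _

/-- Odd operators have vanishing expectation in even states. -/
theorem trace_mul_eq_zero_of_parity {ω B : FockOp n} (hω : parity n * ω = ω * parity n)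
    (hB : parity n * B = -(B * parity n)) : (B * ω).trace = 0 := by
  have h1 : (B * ω).trace = -(B * ω).trace := by
    calc (B * ω).trace = (parity n * (parity n * (B * ω))).trace := by
          rw [← mul_assoc, parity_mul_self, one_mul]
      _ = (parity n * (B * ω) * parity n).trace := Matrix.trace_mul_comm _ _
      _ = -((B * parity n) * (parity n * ω)).trace := by
          rw [← mul_assoc, hB, hω]; simp [mul_assoc]
      _ = -(B * ω).trace := by
          rw [mul_assoc, ← mul_assoc (parity n), parity_mul_self, one_mul]
  exact self_eq_neg.1 h1

end Majorana

/-! ### The continuous limit of repeated steps -/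

section Flow

variable {A F : Type*} [NormedRing A] [NormedAlgebra ℝ A] [CompleteSpace A]
  [NormedAddCommGroup F] [NormedSpace ℝ F] [CompleteSpace F] [Nontrivial F]

/-- The continuous limit of repeated interactions exists, and solves the differential equation
given by the second order term of a single interaction. -/
theorem exists_flow (P : A →L[ℝ] F) (Q : F →L[ℝ] A) (a h : A)
    (hPQ : ∀ x, P (Q x) = x) (hfirst : ∀ x, P (Q x * a - a * Q x) = 0) (x : F) :
    ∃ φ : ℝ → F,
      (∀ t, 0 ≤ t → Tendsto (fun τ : ℝ =>
        (fun y => P (NormedSpace.exp (-(√τ • a + τ • h)) * Q y *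
          NormedSpace.exp (√τ • a + τ • h)))^[⌊t / τ⌋₊] x) (𝓝[>] 0) (𝓝 (φ t))) ∧
      ∀ t, HasDerivAt φ (P (Q (φ t) * h - h * Q (φ t) + (1 / 2 : ℝ) •
        (a * (a * Q (φ t) - Q (φ t) * a) - (a * Q (φ t) - Q (φ t) * a) * a))) t := by
  -- Compression `B ↦ P ∘ B ∘ Q`, continuous and linear in `B`, so expansions can be pushed through
  -- it.
  let T : (A →L[ℝ] A) →L[ℝ] (F →L[ℝ] F) :=
    (ContinuousLinearMap.compL ℝ F A F P).comp ((ContinuousLinearMap.compL ℝ F A A).flip Q)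
  have hT : ∀ B y, T B y = P (B (Q y)) := fun B y => rfl
  let E : ℝ → F →L[ℝ] F := fun s => T (ContinuousLinearMap.mulLeftRight ℝ A
    (NormedSpace.exp (-(s • a + s ^ 2 • h))) (NormedSpace.exp (s • a + s ^ 2 • h)))
  let G : F →L[ℝ] F := T (ContinuousLinearMap.mulLeftRight ℝ A 1 (h + (1 / 2 : ℝ) • (a * a)) +
    ContinuousLinearMap.mulLeftRight ℝ A (-a) a +
    ContinuousLinearMap.mulLeftRight ℝ A (-h + (1 / 2 : ℝ) • (a * a)) 1)
  have hneg : HasExpansion (fun s : ℝ => NormedSpace.exp (-(s • a + s ^ 2 • h))) 1 (-a)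
      (-h + (1 / 2 : ℝ) • (a * a)) := by
    have := HasExpansion.exp (-a) (-h)
    simpa only [smul_neg, ← neg_add, neg_mul_neg] using this
  have hE := (hneg.bilinear (ContinuousLinearMap.mulLeftRight ℝ A) (HasExpansion.exp a h)).map T
  have h0 : T (ContinuousLinearMap.mulLeftRight ℝ A 1 1) = 1 := by
    ext y; simp [hT, hPQ]
  have h1 : T (ContinuousLinearMap.mulLeftRight ℝ A 1 a +
      ContinuousLinearMap.mulLeftRight ℝ A (-a) 1) = 0 := by
    ext y
    simpa [hT, sub_eq_add_neg] using hfirst y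
  rw [h0, h1] at hE
  -- Substituting `s = √τ` turns the error `o(s²)` into `o(τ)`; this needs the vanishing first order
  -- term `h1`.
  have hsqrt : Tendsto (fun τ : ℝ => √τ) (𝓝[>] 0) (𝓝[>] 0) := by
    refine tendsto_nhdsWithin_iff.2 ⟨?_, ?_⟩
    · simpa using (Real.continuous_sqrt.tendsto 0).mono_left nhdsWithin_le_nhds
    · filter_upwards [self_mem_nhdsWithin] with τ hτ using Real.sqrt_pos.2 hτ
  have hS : (fun τ => E (√τ) - (1 + τ • G)) =o[𝓝[>] 0] fun τ : ℝ => τ := by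
    refine (hE.comp_tendsto hsqrt).congr' ?_ ?_
    · filter_upwards [self_mem_nhdsWithin] with τ (hτ : 0 < τ)
      simp only [Function.comp_apply, Real.sq_sqrt hτ.le, smul_zero, add_zero, E, G]
    · filter_upwards [self_mem_nhdsWithin] with τ (hτ : 0 < τ)
      simp only [Function.comp_apply, Real.sq_sqrt hτ.le]
  refine ⟨fun t => NormedSpace.exp (t • G) x, fun t ht => ?_, fun t => ?_⟩
  · have hlim := ((ContinuousLinearMap.apply ℝ F x).continuous.tendsto _).comp
      (tendsto_pow_floor_exp hS ht)
    refine hlim.congr' ?_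
    filter_upwards [self_mem_nhdsWithin] with τ (hτ : 0 < τ)
    rw [Function.comp_apply, ContinuousLinearMap.apply_apply, FunLike.coe_pow_eq_iterate]
    congr 2
    ext y
    simp only [E, hT, Real.sq_sqrt hτ.le, ContinuousLinearMap.mulLeftRight_apply]
  · have hd := ((ContinuousLinearMap.apply ℝ F x).hasFDerivAt.comp_hasDerivAt t
      (hasDerivAt_exp_smul_const' (𝕂 := ℝ) G t))
    refine hd.congr_deriv ?_
    beta_reduce
    rw [ContinuousLinearMap.apply_apply, mul_apply_eq_comp]
    generalize (NormedSpace.exp (t • G)) x = y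
    simp only [G, hT, add_apply, ContinuousLinearMap.mulLeftRight_apply]
    congr 1
    simp only [one_mul, mul_one, mul_add, add_mul, mul_smul_comm, smul_mul_assoc, neg_mul,
      mul_sub, sub_mul, mul_assoc]
    module

end Flow

/-! ### Commutators of quadratic expressions in anticommuting generators -/

section Commutators

variable {R ι κ : Type*} [Ring R] [Algebra ℂ R] [Fintype ι] [Fintype κ]
  {x : ι → R} {y : κ → R}

/-- `[x_k x_l, x_a] = x_k {x_l, x_a} - {x_k, x_a} x_l`; antisymmetry of `r` makes the two sums
equal. The prefactor is that of `iH_S` for `T_S = i r`: two factors `1/2` and `i² = -1`. -/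
theorem commutator_quadratic [DecidableEq ι]
    (hx : ∀ k l, x k * x l + x l * x k = if k = l then 2 else 0) (r : Matrix ι ι ℂ)
    (hr : rᵀ = -r) (a : ι) :
    ((-1 / 4 : ℂ) • ∑ k, ∑ l, r k l • (x k * x l)) * x a -
      x a * ((-1 / 4 : ℂ) • ∑ k, ∑ l, r k l • (x k * x l)) = ∑ l, r a l • x l := by
  have hc : ∀ k l, x k * x l * x a - x a * (x k * x l) =
      (if l = a then (2 : ℂ) • x k else 0) - (if k = a then (2 : ℂ) • x l else 0) := by
    intro k l
    have h1 := congrArg (x k * ·) (hx l a)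
    have h2 := congrArg (· * x l) (hx k a)
    have h3 : x k * x l * x a - x a * (x k * x l) =
        x k * (if l = a then 2 else 0) - (if k = a then 2 else 0) * x l := by
      rw [← hx l a, ← hx k a]; noncomm_ring
    rw [h3, two_smul, two_smul]
    congr 1
    · split_ifs <;> simp [mul_two]
    · split_ifs <;> simp [two_mul]
  have hr' : ∀ k, r k a = -r a k := fun k => congrFun (congrFun hr a) k
  simp only [smul_mul_assoc, mul_smul_comm, Finset.sum_mul, Finset.mul_sum, ← smul_sub,
    ← Finset.sum_sub_distrib, hc]
  simp only [smul_sub, Finset.sum_sub_distrib, smul_ite, smul_zero, Finset.sum_ite_eq',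
    Finset.mem_univ, if_true]
  rw [Finset.sum_comm (f := fun k l => if k = a then r k l • (2 : ℂ) • x l else 0)]
  simp only [Finset.sum_ite_eq', Finset.mem_univ, if_true, ← Finset.sum_sub_distrib,
    Finset.smul_sum, hr']
  exact Finset.sum_congr rfl fun k _ => by module

theorem commutator_bilinear_left [DecidableEq ι]
    (hx : ∀ k l, x k * x l + x l * x k = if k = l then 2 else 0)
    (hxy : ∀ k l, y l * x k = -(x k * y l)) (w : Matrix ι κ ℂ) (a : ι) :
    ((-1 / 2 : ℂ) • ∑ k, ∑ l, w k l • (x k * y l)) * x a -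
      x a * ((-1 / 2 : ℂ) • ∑ k, ∑ l, w k l • (x k * y l)) = ∑ l, w a l • y l := by
  have hc : ∀ k l, x k * y l * x a - x a * (x k * y l) =
      if k = a then (-2 : ℂ) • y l else 0 := by
    intro k l
    have h3 : x k * y l * x a - x a * (x k * y l) = -((if k = a then 2 else 0) * y l) := by
      rw [← hx k a, mul_assoc, hxy]; noncomm_ring
    rw [h3, neg_smul, two_smul]
    split_ifs <;> simp [two_mul]
  simp only [smul_mul_assoc, mul_smul_comm, Finset.sum_mul, Finset.mul_sum, ← smul_sub,
    ← Finset.sum_sub_distrib, hc]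
  rw [Finset.sum_comm]
  simp only [smul_ite, smul_zero, Finset.sum_ite_eq', Finset.mem_univ, if_true,
    Finset.smul_sum]
  exact Finset.sum_congr rfl fun k _ => by module

theorem commutator_bilinear_right [DecidableEq κ]
    (hy : ∀ k l, y k * y l + y l * y k = if k = l then 2 else 0)
    (hxy : ∀ k l, y l * x k = -(x k * y l)) (w : Matrix ι κ ℂ) (b : κ) :
    ((-1 / 2 : ℂ) • ∑ k, ∑ l, w k l • (x k * y l)) * y b -
      y b * ((-1 / 2 : ℂ) • ∑ k, ∑ l, w k l • (x k * y l)) = -∑ k, w k b • x k := by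
  have hc : ∀ k l, x k * y l * y b - y b * (x k * y l) =
      if l = b then (2 : ℂ) • x k else 0 := by
    intro k l
    have h3 : x k * y l * y b - y b * (x k * y l) = x k * (if l = b then 2 else 0) := by
      rw [← hy l b, ← mul_assoc (y b), hxy]; noncomm_ring
    rw [h3, two_smul]
    split_ifs <;> simp [mul_two]
  simp only [smul_mul_assoc, mul_smul_comm, Finset.sum_mul, Finset.mul_sum, ← smul_sub,
    ← Finset.sum_sub_distrib, hc]
  simp only [smul_ite, smul_zero, Finset.sum_ite_eq', Finset.mem_univ, if_true,
    Finset.smul_sum, ← Finset.sum_neg_distrib]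
  exact Finset.sum_congr rfl fun k _ => by module

/-- `[q, ·]` is a derivation, so the Leibniz rule is applied twice. The two mixed terms coincide,
whence the factor `2`. -/
theorem double_commutator_bilinear [DecidableEq ι] [DecidableEq κ]
    (hx : ∀ k l, x k * x l + x l * x k = if k = l then 2 else 0)
    (hy : ∀ k l, y k * y l + y l * y k = if k = l then 2 else 0)
    (hxy : ∀ k l, y l * x k = -(x k * y l)) (w : Matrix ι κ ℂ) {q : R}
    (hq : q = (-1 / 2 : ℂ) • ∑ k, ∑ l, w k l • (x k * y l)) (a b : ι) :
    q * (q * (x a * x b) - x a * x b * q) - (q * (x a * x b) - x a * x b * q) * q =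
      (2 : ℂ) • ((∑ l, w a l • y l) * ∑ m, w b m • y m) -
        ((∑ k, (w * wᵀ) a k • x k) * x b + x a * ∑ k, (w * wᵀ) b k • x k) := by
  have h1 : ∀ c, q * x c - x c * q = ∑ l, w c l • y l := fun c => by
    rw [hq]; exact commutator_bilinear_left hx hxy w c
  have h2 : ∀ c, q * (∑ l, w c l • y l) - (∑ l, w c l • y l) * q =
      -∑ k, (w * wᵀ) c k • x k := by
    intro c
    simp only [Finset.mul_sum, Finset.sum_mul, mul_smul_comm, smul_mul_assoc,
      ← Finset.sum_sub_distrib, ← smul_sub, Matrix.mul_apply, Finset.sum_smul]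
    rw [Finset.sum_comm, ← Finset.sum_neg_distrib]
    refine Finset.sum_congr rfl fun l _ => ?_
    rw [hq, commutator_bilinear_right hy hxy w l, smul_neg, Finset.smul_sum]
    simp only [smul_smul, Matrix.transpose_apply]
  have h3 : q * (x a * x b) - x a * x b * q =
      (∑ l, w a l • y l) * x b + x a * ∑ l, w b l • y l := by
    rw [← h1, ← h1]; noncomm_ring
  have h4 : q * ((∑ l, w a l • y l) * x b + x a * ∑ l, w b l • y l) -
      ((∑ l, w a l • y l) * x b + x a * ∑ l, w b l • y l) * q =
      (q * (∑ l, w a l • y l) - (∑ l, w a l • y l) * q) * x b +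
      (∑ l, w a l • y l) * (q * x b - x b * q) + (q * x a - x a * q) * (∑ l, w b l • y l) +
      x a * (q * (∑ l, w b l • y l) - (∑ l, w b l • y l) * q) := by
    noncomm_ring
  rw [h3, h4, h2, h2, h1, h1, two_smul]
  noncomm_ring

end Commutators

/-! ### System and bath on the tensor product -/

section Joint

variable {L K : ℕ}

theorem majorana_kronecker_right {n : ℕ} {ι κ : Type} (F : Modes n → Matrix ι ι ℂ)
    (B : Matrix κ κ ℂ) (k : Modes n) :
    majorana (fun j => F j ⊗ₖ B) k = majorana F k ⊗ₖ B := by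
  ext u v
  simp only [majorana, Matrix.sum_apply, Matrix.smul_apply, Matrix.kroneckerMap_apply,
    Finset.sum_mul, smul_eq_mul, mul_assoc]

theorem majorana_kronecker_left {n : ℕ} {ι κ : Type} (F : Modes n → Matrix ι ι ℂ)
    (B : Matrix κ κ ℂ) (k : Modes n) :
    majorana (fun j => B ⊗ₖ F j) k = B ⊗ₖ majorana F k := by
  ext u v
  simp only [majorana, Matrix.sum_apply, Matrix.smul_apply, Matrix.kroneckerMap_apply,
    Finset.mul_sum, smul_eq_mul, mul_left_comm]

theorem majorana_systemColumn (e : TensorConvention) (k : Modes L) :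
    majorana (systemColumn L K e) k = majorana (column L) k ⊗ₖ
      (match e with | .SB => (1 : FockOp K) | .BS => parity K) := by
  cases e
  · exact majorana_kronecker_right _ _ k
  · exact majorana_kronecker_right _ _ k

theorem majorana_bathColumn (e : TensorConvention) (l : Modes K) :
    majorana (bathColumn L K e) l =
      (match e with | .SB => parity L | .BS => (1 : FockOp L)) ⊗ₖ majorana (column K) l := by
  cases e
  · exact majorana_kronecker_left _ _ l
  · exact majorana_kronecker_left _ _ l

/-- Parity squares to one, so quadratic observables of one subsystem do not see the convention. -/
theorem majorana_systemColumn_mul (e : TensorConvention) (k l : Modes L) :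
    majorana (systemColumn L K e) k * majorana (systemColumn L K e) l =
      (majorana (column L) k * majorana (column L) l) ⊗ₖ (1 : FockOp K) := by
  rw [majorana_systemColumn, majorana_systemColumn, ← Matrix.mul_kronecker_mul]
  cases e
  · rw [one_mul]
  · rw [parity_mul_self]

theorem majorana_bathColumn_mul (e : TensorConvention) (k l : Modes K) :
    majorana (bathColumn L K e) k * majorana (bathColumn L K e) l =
      (1 : FockOp L) ⊗ₖ (majorana (column K) k * majorana (column K) l) := by
  rw [majorana_bathColumn, majorana_bathColumn, ← Matrix.mul_kronecker_mul]
  cases e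
  · rw [parity_mul_self]
  · rw [one_mul]

theorem majorana_systemColumn_anticomm (e : TensorConvention) (k l : Modes L) :
    majorana (systemColumn L K e) k * majorana (systemColumn L K e) l +
      majorana (systemColumn L K e) l * majorana (systemColumn L K e) k =
      if k = l then 2 else 0 := by
  rw [majorana_systemColumn_mul, majorana_systemColumn_mul, ← Matrix.add_kronecker,
    majorana_anticomm]
  split_ifs
  · rw [← one_add_one_eq_two, Matrix.add_kronecker, Matrix.one_kronecker_one, one_add_one_eq_two]
  · exact Matrix.zero_kronecker _

theorem majorana_bathColumn_anticomm (e : TensorConvention) (k l : Modes K) :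
    majorana (bathColumn L K e) k * majorana (bathColumn L K e) l +
      majorana (bathColumn L K e) l * majorana (bathColumn L K e) k =
      if k = l then 2 else 0 := by
  rw [majorana_bathColumn_mul, majorana_bathColumn_mul, ← Matrix.kronecker_add,
    majorana_anticomm]
  split_ifs
  · rw [← one_add_one_eq_two, Matrix.kronecker_add, Matrix.one_kronecker_one, one_add_one_eq_two]
  · exact Matrix.kronecker_zero _

theorem neg_kronecker' {ι κ : Type} (A : Matrix ι ι ℂ) (B : Matrix κ κ ℂ) :
    (-A) ⊗ₖ B = -(A ⊗ₖ B) := by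
  ext; simp

theorem kronecker_neg' {ι κ : Type} (A : Matrix ι ι ℂ) (B : Matrix κ κ ℂ) :
    A ⊗ₖ (-B) = -(A ⊗ₖ B) := by
  ext; simp

theorem majorana_bath_mul_system (e : TensorConvention) (k : Modes L) (l : Modes K) :
    majorana (bathColumn L K e) l * majorana (systemColumn L K e) k =
      -(majorana (systemColumn L K e) k * majorana (bathColumn L K e) l) := by
  rw [majorana_systemColumn, majorana_bathColumn, ← Matrix.mul_kronecker_mul,
    ← Matrix.mul_kronecker_mul]
  cases e
  · rw [parity_mul_majorana, one_mul, mul_one, neg_kronecker']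
  · rw [parity_mul_majorana, one_mul, mul_one, kronecker_neg', neg_neg]

theorem majorana_systemColumn_isHermitian (e : TensorConvention) (k : Modes L) :
    (majorana (systemColumn L K e) k)ᴴ = majorana (systemColumn L K e) k := by
  rw [majorana_systemColumn, Matrix.conjTranspose_kronecker, majorana_isHermitian]
  cases e
  · rw [Matrix.conjTranspose_one]
  · rw [parity_conjTranspose]

theorem smul_interaction (e : TensorConvention) (w : Matrix (Modes L) (Modes K) ℂ) :
    Complex.I • interaction e (Complex.I • w) = (-1 / 2 : ℂ) • ∑ k, ∑ l, w k l •
      (majorana (systemColumn L K e) k * majorana (bathColumn L K e) l) := by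
  rw [interaction, sandwich_ofMajorana]
  simp only [majorana_systemColumn_isHermitian, Matrix.smul_apply, smul_eq_mul, mul_smul,
    ← Finset.smul_sum]
  simp only [smul_smul]
  congr 1
  linear_combination (1 / 2 : ℂ) * Complex.I_mul_I

theorem smul_hamiltonian (e : TensorConvention) (r : Matrix (Modes L) (Modes L) ℂ) :
    Complex.I • (hamiltonian (Complex.I • r) ⊗ₖ (1 : FockOp K)) =
      (-1 / 4 : ℂ) • ∑ k, ∑ l, r k l •
      (majorana (systemColumn L K e) k * majorana (systemColumn L K e) l) := by
  have h : ∑ k, ∑ l, r k l •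
      (majorana (systemColumn L K e) k * majorana (systemColumn L K e) l) =
      (∑ k, ∑ l, r k l • (majorana (column L) k * majorana (column L) l)) ⊗ₖ (1 : FockOp K) := by
    ext u v
    simp only [majorana_systemColumn_mul, Matrix.sum_apply, Matrix.smul_apply,
      Matrix.kroneckerMap_apply, Finset.sum_mul, smul_eq_mul, mul_assoc]
  rw [h, hamiltonian, sandwich_ofMajorana]
  simp only [majorana_isHermitian, Matrix.smul_apply, smul_eq_mul, mul_smul,
    ← Finset.smul_sum, Matrix.smul_kronecker]
  simp only [smul_smul]
  congr 1
  linear_combination (1 / 4 : ℂ) * Complex.I_mul_I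

theorem traceBath_kronecker_mul (A ρ : FockOp L) (B ω : FockOp K) :
    traceBath ((A ⊗ₖ B) * (ρ ⊗ₖ ω)) = (B * ω).trace • (A * ρ) := by
  ext u v
  simp [traceBath, ← Matrix.mul_kronecker_mul, Matrix.trace, Finset.mul_sum, mul_comm]

theorem traceBath_mul_kronecker (A ρ : FockOp L) (B ω : FockOp K) :
    traceBath ((ρ ⊗ₖ ω) * (A ⊗ₖ B)) = (B * ω).trace • (ρ * A) := by
  rw [Matrix.trace_mul_comm]
  ext u v
  simp [traceBath, ← Matrix.mul_kronecker_mul, Matrix.trace, Finset.mul_sum, mul_comm]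

theorem trace_traceBath_mul (X : JointOp L K) (O : FockOp L) :
    (traceBath X * O).trace = (X * (O ⊗ₖ (1 : FockOp K))).trace := by
  simp only [Matrix.trace, Matrix.diag_apply, Matrix.mul_apply, traceBath, Matrix.of_apply,
    Fintype.sum_prod_type, Matrix.kroneckerMap_apply, Matrix.one_apply, Finset.sum_mul,
    mul_ite, mul_one, mul_zero, Finset.sum_ite_eq', Finset.mem_univ, if_true]
  refine Finset.sum_congr rfl fun u _ => ?_
  rw [Finset.sum_comm]

/-- The partial trace as a linear map. -/
def traceBathLin (L K : ℕ) : JointOp L K →ₗ[ℝ] FockOp L where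
  toFun := traceBath
  map_add' X Y := by ext; simp [traceBath, Finset.sum_add_distrib]
  map_smul' c X := by ext; simp [traceBath, Finset.mul_sum]

/-- Adjoining the bath state, as a linear map. -/
def tensorBathLin (L : ℕ) {K : ℕ} (ω : FockOp K) : FockOp L →ₗ[ℝ] JointOp L K where
  toFun ρ := ρ ⊗ₖ ω
  map_add' X Y := Matrix.add_kronecker X Y ω
  map_smul' c X := Matrix.smul_kronecker c X ω

/-- In either convention each summand of `q` is `A ⊗ B` with `B` odd, so the even state `ω` gives it
zero expectation. This removes the first order term of a step, which would diverge as `1/√τ` after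
division by `τ`. -/
theorem traceBath_commutator_interaction (e : TensorConvention)
    (w : Matrix (Modes L) (Modes K) ℂ) {ω : FockOp K}
    (hω : parity K * ω = ω * parity K) (ρ : FockOp L) {q : JointOp L K}
    (hq : q = (-1 / 2 : ℂ) • ∑ k, ∑ l, w k l •
      (majorana (systemColumn L K e) k * majorana (bathColumn L K e) l)) :
    traceBath ((ρ ⊗ₖ ω) * q - q * (ρ ⊗ₖ ω)) = 0 := by
  have hodd : ∀ (k : Modes L) (l : Modes K), ∃ (A : FockOp L) (B : FockOp K),
      majorana (systemColumn L K e) k * majorana (bathColumn L K e) l = A ⊗ₖ B ∧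
      (B * ω).trace = 0 := by
    intro k l
    rw [majorana_systemColumn, majorana_bathColumn, ← Matrix.mul_kronecker_mul]
    refine ⟨_, _, rfl, trace_mul_eq_zero_of_parity hω ?_⟩
    cases e
    · rw [one_mul, parity_mul_majorana]
    · dsimp only
      rw [mul_assoc, ← mul_neg, ← parity_mul_majorana]
  have hadd : ∀ X Y : JointOp L K, traceBath (X + Y) = traceBath X + traceBath Y :=
    (traceBathLin L K).map_add
  have hsmul : ∀ (c : ℂ) (X : JointOp L K), traceBath (c • X) = c • traceBath X := fun c X => by
    ext; simp [traceBath, Finset.mul_sum]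
  -- Complex linearity is needed here, since the coefficients of `q` are complex.
  let T : JointOp L K →ₗ[ℂ] FockOp L := ⟨⟨traceBath, hadd⟩, hsmul⟩
  change T _ = 0
  rw [hq]
  simp only [mul_smul_comm, smul_mul_assoc, Finset.mul_sum, Finset.sum_mul, map_sub, map_smul,
    map_sum]
  have h1 : ∀ k l, T ((ρ ⊗ₖ ω) *
      (majorana (systemColumn L K e) k * majorana (bathColumn L K e) l)) = 0 := fun k l => by
    obtain ⟨A, B, h, h0⟩ := hodd k l
    rw [h]
    exact (traceBath_mul_kronecker A ρ B ω).trans (by rw [h0, zero_smul])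
  have h2 : ∀ k l, T (
      (majorana (systemColumn L K e) k * majorana (bathColumn L K e) l) * (ρ ⊗ₖ ω)) = 0 :=
    fun k l => by
      obtain ⟨A, B, h, h0⟩ := hodd k l
      rw [h]
      exact (traceBath_kronecker_mul A ρ B ω).trans (by rw [h0, zero_smul])
  simp [h1, h2]

end Joint

/-! ### Transfer to matrices -/

section Normed

attribute [local instance] Matrix.linftyOpNormedRing Matrix.linftyOpNormedAlgebra

/-- Any submultiplicative norm serves, and it stays local: derivatives are stated only after a
scalar functional `f`, so the conclusion depends on the topology alone. -/
theorem exists_matrix_flow {ι κ : Type} [Fintype ι] [DecidableEq ι] [Nonempty ι] [Fintype κ]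
    [DecidableEq κ] (P : Matrix κ κ ℂ →ₗ[ℝ] Matrix ι ι ℂ) (Q : Matrix ι ι ℂ →ₗ[ℝ] Matrix κ κ ℂ)
    (a h : Matrix κ κ ℂ) (hPQ : ∀ x, P (Q x) = x) (hfirst : ∀ x, P (Q x * a - a * Q x) = 0)
    (x : Matrix ι ι ℂ) :
    ∃ φ : ℝ → Matrix ι ι ℂ,
      (∀ t, 0 ≤ t → Tendsto (fun τ : ℝ =>
        (fun y => P (NormedSpace.exp (-(√τ • a + τ • h)) * Q y *
          NormedSpace.exp (√τ • a + τ • h)))^[⌊t / τ⌋₊] x) (𝓝[>] 0) (𝓝 (φ t))) ∧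
      ∀ (f : Matrix ι ι ℂ →ₗ[ℝ] ℂ) t, HasDerivAt (fun s => f (φ s))
        (f (P (Q (φ t) * h - h * Q (φ t) + (1 / 2 : ℝ) •
        (a * (a * Q (φ t) - Q (φ t) * a) - (a * Q (φ t) - Q (φ t) * a) * a)))) t := by
  have : CompleteSpace (Matrix ι ι ℂ) := FiniteDimensional.complete ℝ _
  have : CompleteSpace (Matrix κ κ ℂ) := FiniteDimensional.complete ℝ _
  obtain ⟨φ, h1, h2⟩ := exists_flow P.toContinuousLinearMap Q.toContinuousLinearMap a h hPQ
    hfirst x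
  exact ⟨φ, h1, fun f t => f.toContinuousLinearMap.hasFDerivAt.comp_hasDerivAt t (h2 t)⟩

theorem exp_neg_mul_exp {κ : Type} [Fintype κ] [DecidableEq κ] (a : Matrix κ κ ℂ) :
    NormedSpace.exp a * NormedSpace.exp (-a) = 1 := by
  rw [← Matrix.exp_add_of_commute _ _ (Commute.refl a).neg_right, add_neg_cancel,
    NormedSpace.exp_zero]

end Normed

/-! ### The covariance master equation -/

section Main

variable {L K : ℕ}

/-- The exponentials are mutually inverse and the trace is cyclic. Unit trace along the flow is what
gives the inhomogeneous bath term coefficient one. -/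
theorem trace_interactionStep (e : TensorConvention) (TS : Matrix (Modes L) (Modes L) ℂ)
    (TB : Matrix (Modes K) (Modes K) ℂ) (Θ : Matrix (Modes L) (Modes K) ℂ) {ω : FockOp K}
    (hω : ω.trace = 1) (τ : ℝ) (ρ : FockOp L) :
    (interactionStep e TS TB Θ ω τ ρ).trace = ρ.trace := by
  have h := trace_traceBath_mul
    (NormedSpace.exp (-(Complex.I * (τ : ℂ)) • totalHamiltonian e TS TB Θ (1 / √τ)) *
      (ρ ⊗ₖ ω) *
      NormedSpace.exp ((Complex.I * (τ : ℂ)) • totalHamiltonian e TS TB Θ (1 / √τ))) 1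
  rw [mul_one, Matrix.one_kronecker_one, mul_one, neg_smul, mul_assoc, Matrix.trace_mul_comm,
    mul_assoc, exp_neg_mul_exp, mul_one, Matrix.trace_kronecker, hω, mul_one] at h
  rw [interactionStep, neg_smul]
  rwa [mul_assoc]

theorem trace_repeatedEvolution (e : TensorConvention) (TS : Matrix (Modes L) (Modes L) ℂ)
    (TB : Matrix (Modes K) (Modes K) ℂ) (Θ : Matrix (Modes L) (Modes K) ℂ) {ω : FockOp K}
    (hω : ω.trace = 1) (τ t : ℝ) (ρ : FockOp L) :
    (repeatedEvolution e TS TB Θ ω τ t ρ).trace = ρ.trace := by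
  rw [repeatedEvolution]
  induction ⌊t / τ⌋₊ with
  | zero => rfl
  | succ n ih => rw [Function.iterate_succ_apply', trace_interactionStep e TS TB Θ hω, ih]

theorem smul_totalHamiltonian (e : TensorConvention) (TS : Matrix (Modes L) (Modes L) ℂ)
    (TB : Matrix (Modes K) (Modes K) ℂ) (Θ : Matrix (Modes L) (Modes K) ℂ) (τ : ℝ) :
    (Complex.I * (τ : ℂ)) • totalHamiltonian e TS TB Θ (1 / √τ) =
      √τ • (Complex.I • interaction e Θ) +
      τ • (Complex.I • (hamiltonian TS ⊗ₖ (1 : FockOp K)) +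
        Complex.I • ((1 : FockOp L) ⊗ₖ hamiltonian TB)) := by
  -- True for every real `τ`: when `τ ≤ 0` both sides are zero by the default values of root and
  -- division.
  have h : ((τ : ℝ) : ℂ) * ((1 / √τ : ℝ) : ℂ) = ((√τ : ℝ) : ℂ) := by
    rw [← Complex.ofReal_mul, mul_one_div, Real.div_sqrt]
  rw [totalHamiltonian, ← Complex.coe_smul (√τ), ← Complex.coe_smul τ, ← h]
  module

/-- Passage to the Heisenberg picture by cyclicity: a single commutator changes sign when moved, a
double one does not. -/
theorem trace_commutators_mul {κ : Type} [Fintype κ] (X Y h q : Matrix κ κ ℂ) :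
    ((X * h - h * X + (1 / 2 : ℝ) •
      (q * (q * X - X * q) - (q * X - X * q) * q)) * Y).trace =
      (X * (h * Y - Y * h + (1 / 2 : ℝ) •
      (q * (q * Y - Y * q) - (q * Y - Y * q) * q))).trace := by
  have h2 : (h * X * Y).trace = (X * Y * h).trace := by
    rw [mul_assoc, Matrix.trace_mul_comm]
  have h3 : (q * q * X * Y).trace = (X * Y * q * q).trace := by
    rw [mul_assoc, Matrix.trace_mul_comm, ← mul_assoc]
  have h4 : (q * X * q * Y).trace = (X * q * Y * q).trace := by
    rw [mul_assoc q, mul_assoc q, Matrix.trace_mul_comm]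
  simp only [mul_sub, sub_mul, mul_add, add_mul, smul_mul_assoc, mul_smul_comm,
    Matrix.trace_sub, Matrix.trace_add, Matrix.trace_smul, ← mul_assoc, h2, h3, h4,
    Complex.real_smul]
  ring

/-- The covariance matrix of the second order term of one interaction. -/
theorem covarianceMatrix_generator (e : TensorConvention) {r : Matrix (Modes L) (Modes L) ℂ}
    (hr : rᵀ = -r) (w : Matrix (Modes L) (Modes K) ℂ) (HB : FockOp K) {ω : FockOp K}
    (hω : ω.trace = 1) {ρ : FockOp L} (hρ : ρ.trace = 1) {X q h : JointOp L K}
    (hX : X = ρ ⊗ₖ ω)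
    (hq : q = (-1 / 2 : ℂ) • ∑ k, ∑ l, w k l •
      (majorana (systemColumn L K e) k * majorana (bathColumn L K e) l))
    (hh : h = (-1 / 4 : ℂ) • (∑ k, ∑ l, r k l •
      (majorana (systemColumn L K e) k * majorana (systemColumn L K e) l)) +
      (1 : FockOp L) ⊗ₖ HB) (a b : Modes L) :
    covarianceMatrix (traceBath (X * h - h * X + (1 / 2 : ℝ) •
      (q * (q * X - X * q) - (q * X - X * q) * q))) a b =
    (r * covarianceMatrix ρ - covarianceMatrix ρ * r
      - (1 / 2 : ℂ) • ((w * wᵀ) * covarianceMatrix ρ + covarianceMatrix ρ * (w * wᵀ))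
      + w * covarianceMatrix ω * wᵀ) a b := by
  set x := majorana (systemColumn L K e) with hx
  set y := majorana (bathColumn L K e) with hy
  have hxx : ∀ k l, (X * (x k * x l)).trace = 2 * covarianceMatrix ρ k l := fun k l => by
    rw [hX, hx, majorana_systemColumn_mul, ← Matrix.mul_kronecker_mul, Matrix.trace_kronecker,
      mul_one, hω, covarianceMatrix_apply]; ring
  have hyy : ∀ k l, (X * (y k * y l)).trace = 2 * covarianceMatrix ω k l := fun k l => by
    rw [hX, hy, majorana_bathColumn_mul, ← Matrix.mul_kronecker_mul, Matrix.trace_kronecker,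
      mul_one, hρ, covarianceMatrix_apply]; ring
  -- The bath Hamiltonian commutes with system observables, hence is absent from the equation.
  have hHB : ((1 : FockOp L) ⊗ₖ HB) * (x a * x b) - (x a * x b) * ((1 : FockOp L) ⊗ₖ HB) = 0 := by
    rw [hx, majorana_systemColumn_mul, ← Matrix.mul_kronecker_mul, ← Matrix.mul_kronecker_mul]
    simp
  have hcar : ∀ k l, x k * x l + x l * x k = if k = l then 2 else 0 :=
    majorana_systemColumn_anticomm e
  have hcar' : ∀ k l, y k * y l + y l * y k = if k = l then 2 else 0 :=
    majorana_bathColumn_anticomm e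
  have hh' : h * (x a * x b) - (x a * x b) * h =
      (∑ l, r a l • x l) * x b + x a * ∑ l, r b l • x l := by
    rw [← commutator_quadratic hcar r hr, ← commutator_quadratic hcar r hr, hh, add_mul, mul_add,
      add_sub_add_comm, hHB]
    noncomm_ring
  rw [covarianceMatrix_apply, trace_traceBath_mul, ← majorana_systemColumn_mul e, ← hx, trace_commutators_mul, hh',
    double_commutator_bilinear hcar hcar'
      (majorana_bath_mul_system e) w hq]
  -- Right factors are written as transposes because the commutators produce row coefficients `r b
  -- i` and `(w * wᵀ) b i`.
  have hrT : covarianceMatrix ρ * r = -(covarianceMatrix ρ * rᵀ) := by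
    rw [hr, mul_neg, neg_neg]
  have hwT : covarianceMatrix ρ * (w * wᵀ) = covarianceMatrix ρ * (w * wᵀ)ᵀ := by
    rw [Matrix.transpose_mul, Matrix.transpose_transpose]
  rw [hrT, hwT]
  simp only [mul_add, mul_sub, Finset.sum_mul, Finset.mul_sum, smul_mul_assoc, mul_smul_comm,
    Matrix.trace_add, Matrix.trace_sub, Matrix.trace_smul, Matrix.trace_sum, hxx, hyy,
    Complex.real_smul, smul_eq_mul]
  have hl : ∀ (c : ℂ) (p : Matrix (Modes L) (Modes L) ℂ),
      ∑ i, c * (p a i * (2 * covarianceMatrix ρ i b)) = 2 * c * (p * covarianceMatrix ρ) a b := by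
    intro c p
    rw [Matrix.mul_apply, Finset.mul_sum]
    exact Finset.sum_congr rfl fun i _ => by ring
  have hr : ∀ (c : ℂ) (p : Matrix (Modes L) (Modes L) ℂ),
      ∑ i, c * (p b i * (2 * covarianceMatrix ρ a i)) = 2 * c * (covarianceMatrix ρ * pᵀ) a b := by
    intro c p
    rw [Matrix.mul_apply, Finset.mul_sum]
    exact Finset.sum_congr rfl fun i _ => by rw [Matrix.transpose_apply]; ring
  have hw : ∑ m, ∑ l, (2 * (w b m * (w a l * (2 * covarianceMatrix ω l m)))) =
      4 * (w * covarianceMatrix ω * wᵀ) a b := by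
    rw [Matrix.mul_apply, Finset.mul_sum]
    refine Finset.sum_congr rfl fun m _ => ?_
    rw [Matrix.mul_apply, Finset.sum_mul, Finset.mul_sum]
    exact Finset.sum_congr rfl fun l _ => by rw [Matrix.transpose_apply]; ring
  simp only [← mul_assoc (1 / 2 : ℂ) ((1 / 2 : ℝ) : ℂ), ← Finset.mul_sum] at hl hr hw ⊢
  simp only [hl, hr, hw, Matrix.add_apply, Matrix.sub_apply, Matrix.neg_apply, Matrix.smul_apply,
    smul_eq_mul]
  push_cast
  ring

theorem exists_limit_flow (e : TensorConvention)
    {r : Matrix (Modes L) (Modes L) ℂ} (hr : rᵀ = -r) (TB : Matrix (Modes K) (Modes K) ℂ)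
    (w : Matrix (Modes L) (Modes K) ℂ) {ω : FockOp K} (hω : ω.trace = 1)
    (hpar : parity K * ω = ω * parity K) {ρ : FockOp L} (hρ : ρ.trace = 1) :
    ∃ φ : ℝ → FockOp L,
      (∀ t, 0 ≤ t → Tendsto (fun τ => repeatedEvolution e (Complex.I • r) TB (Complex.I • w) ω τ t ρ)
        (𝓝[>] 0) (𝓝 (φ t))) ∧
      ∀ t, 0 ≤ t → ∀ a b, HasDerivAt (fun s => covarianceMatrix (φ s) a b)
        ((r * covarianceMatrix (φ t) - covarianceMatrix (φ t) * r
          - (1 / 2 : ℂ) • ((w * wᵀ) * covarianceMatrix (φ t) + covarianceMatrix (φ t) * (w * wᵀ))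
          + w * covarianceMatrix ω * wᵀ) a b) t := by
  have hPQ : ∀ σ : FockOp L, traceBathLin L K (tensorBathLin L ω σ) = σ := fun σ => by
    have := traceBath_kronecker_mul 1 σ 1 ω
    rw [Matrix.one_kronecker_one, one_mul, one_mul, one_mul, hω, one_smul] at this
    exact this
  obtain ⟨φ, h1, h2⟩ := exists_matrix_flow (traceBathLin L K) (tensorBathLin L ω)
    (Complex.I • interaction e (Complex.I • w))
    (Complex.I • (hamiltonian (Complex.I • r) ⊗ₖ (1 : FockOp K)) +
        Complex.I • ((1 : FockOp L) ⊗ₖ hamiltonian TB)) hPQ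
    (fun σ => traceBath_commutator_interaction e w hpar σ (smul_interaction e w)) ρ
  have hlim : ∀ t, 0 ≤ t → Tendsto
      (fun τ => repeatedEvolution e (Complex.I • r) TB (Complex.I • w) ω τ t ρ)
      (𝓝[>] 0) (𝓝 (φ t)) := fun t ht => by
    refine (h1 t ht).congr fun τ => ?_
    rw [repeatedEvolution]
    congr 1
    ext1 σ
    rw [interactionStep, neg_smul, smul_totalHamiltonian]
    rfl
  refine ⟨φ, hlim, fun t ht a b => ?_⟩
  -- The trace is continuous and constant along the approximants.
  have htr : (φ t).trace = 1 := by
    have hc : Continuous fun σ : FockOp L => σ.trace := Continuous.matrix_trace continuous_id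
    refine tendsto_nhds_unique ((hc.tendsto _).comp (hlim t ht)) ?_
    simp only [Function.comp_def, trace_repeatedEvolution _ _ _ _ hω, hρ]
    exact tendsto_const_nhds
  let f : FockOp L →ₗ[ℝ] ℂ :=
    { toFun := fun σ => covarianceMatrix σ a b
      map_add' := fun σ σ' => by
        simp only [covarianceMatrix_apply, add_mul, Matrix.trace_add, mul_add]
      map_smul' := fun c σ => by
        simp only [covarianceMatrix_apply, smul_mul_assoc, Matrix.trace_smul, mul_smul_comm,
          RingHom.id_apply] }
  refine (h2 f t).congr_deriv ?_
  refine covarianceMatrix_generator e hr w (Complex.I • hamiltonian TB) hω htr rfl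
    (smul_interaction e w) ?_ a b
  rw [smul_hamiltonian, Matrix.kronecker_smul]

end Main

end FermionBath

end

theorem mainTheorem3 (L K : ℕ) (e : FermionBath.TensorConvention)
    (RS : Matrix (FermionBath.Modes L) (FermionBath.Modes L) ℝ) (hRS : RSᵀ = -RS)
    (RB : Matrix (FermionBath.Modes K) (FermionBath.Modes K) ℝ) (hRB : RBᵀ = -RB)
    (W : Matrix (FermionBath.Modes L) (FermionBath.Modes K) ℝ)
    (TS : Matrix (FermionBath.Modes L) (FermionBath.Modes L) ℂ)
    (hTS : TS = FermionBath.imaginary RS)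
    (TB : Matrix (FermionBath.Modes K) (FermionBath.Modes K) ℂ)
    (hTB : TB = FermionBath.imaginary RB)
    (Θ : Matrix (FermionBath.Modes L) (FermionBath.Modes K) ℂ)
    (hΘ : Θ = FermionBath.imaginary W)
    (ω : FermionBath.FockOp K) (hω : FermionBath.IsState ω) (hωqf : FermionBath.IsQuasiFree ω)
    (MB : Matrix (FermionBath.Modes K) (FermionBath.Modes K) ℂ)
    (hMB : MB = FermionBath.covarianceMatrix ω)
    (ρ₀ : FermionBath.FockOp L) (hρ₀ : FermionBath.IsState ρ₀)
    (ρ : ℝ → FermionBath.FockOp L)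
    (hρ : ∀ t, ρ t = FermionBath.limitEvolution e TS TB Θ ω t ρ₀)
    (M : ℝ → Matrix (FermionBath.Modes L) (FermionBath.Modes L) ℂ)
    (hM : ∀ t, M t = FermionBath.covarianceMatrix (ρ t)) :
    (∀ t : ℝ, 0 ≤ t →
      Filter.Tendsto (fun τ : ℝ => FermionBath.repeatedEvolution e TS TB Θ ω τ t ρ₀)
        (𝓝[>] (0 : ℝ)) (𝓝 (ρ t))) ∧
    (∀ t : ℝ, 0 ≤ t → ∀ i j : FermionBath.Modes L,
      HasDerivWithinAt (fun s : ℝ => M s i j)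
        ((-Complex.I • (TS * M t - M t * TS)
          - (1 / 2 : ℂ) • ((Θ * Θᴴ) * M t + M t * (Θ * Θᴴ))
          + Θ * MB * Θᴴ) i j)
        (Set.Ici 0) t) := by
  subst hTS hΘ hMB
  have hr : (RS.map Complex.ofReal)ᵀ = -RS.map Complex.ofReal := by
    rw [← Matrix.transpose_map, hRS]; ext; simp
  obtain ⟨φ, h1, h2⟩ := FermionBath.exists_limit_flow e hr TB (W.map Complex.ofReal) hω.2
    hωqf.parity_comm hρ₀.2
  have hφ : ∀ t, 0 ≤ t → ρ t = φ t := fun t ht => by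
    rw [hρ]; exact (h1 t ht).limUnder_eq
  have hW : (FermionBath.imaginary W)ᴴ = -Complex.I • (W.map Complex.ofReal)ᵀ := by
    ext; simp [FermionBath.imaginary]
  refine ⟨fun t ht => by rw [hφ t ht]; exact h1 t ht, fun t ht i j => ?_⟩
  -- `φ` has a two-sided derivative even at `0`, but `ρ` is known to agree with it only for
  -- nonnegative times.
  have hd := (h2 t ht i j).hasDerivWithinAt (s := Set.Ici 0)
  refine (hd.congr (fun s hs => by rw [hM, hφ s hs]) (by rw [hM, hφ t ht])).congr_deriv ?_
  rw [hW, hM, hφ t ht]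
  simp only [FermionBath.imaginary, Matrix.smul_mul, Matrix.mul_smul, smul_smul, smul_sub,
    neg_mul, Complex.I_mul_I, neg_neg, one_smul]
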